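/- Let $\ell\ge 0$ be an integer, let $K$ be a field of characteristic zero (for instance $\mathbb R$ or $\mathbb C$), and let $b_i,d_i,L_{ijk}\in K$ ($1\le i,j,k\le\ell$) be parameters such that $L_{ijk}$ is symmetric in its three indices, $d_i\neq 0$ for all $i$, and $L_{iij}\ne 0$ for all $i\neq j$; if $\ell=1$, assume moreover that $L_{111}\neq 2b_1d_1$. Consider the homogeneous Einstein equations, i.e. the system $f_1=\dots=f_\ell=0$ of Laurent polynomials in $x_1,\dots,x_\ell$ $$f_i(\mathbf x)=\frac{b_i}{2x_i}-\frac1{4d_i}\sum_{j,k=1}^{\ell}L_{ijk}\,\frac{2x_k^2-x_i^2}{x_ix_jx_k}-1,\qquad 1\le i\le \ell .$$ Let $\operatorname{Newt}(f_i)\subset\mathbb R^\ell$ be the Newton polytope of $f_i$, that is, the convex hull of the exponents of the monomials that occur in $f_i$ with nonzero coefficient. The mixed volume $\operatorname{MV}(P_1,\dots,P_\ell)$ of polytopes in $\mathbb R^\ell$ is the coefficient of $\lambda_1\cdots\lambda_\ell$ in $\operatorname{Vol}(\lambda_1P_1+\dots+\lambda_\ell P_\ell)$, which is a polynomial function of $\lambda_1,\dots,\lambda_\ell>0$.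 Then $$\operatorname{MV}\big(\operatorname{Newt}(f_1),\dots,\operatorname{Newt}(f_\ell)\big)=\ell!\,\operatorname{Vol}\big(\widetilde P^\ell\big),\qquad \widetilde P^\ell=\operatorname{conv}\big(\mathbf 0,\ \mathbf e_i-2\mathbf e_j : i,j\in\{1,\dots,\ell\}\big).$$ -/

import Mathlib

open MeasureTheory
open scoped Pointwise Nat

noncomputable section

/-- Laurent polynomials over `K` in the variables `x_i`, `i : Fin l`:
finite `K`-linear combinations of monomials `x ^ a` with `a : Fin l → ℤ`. -/
abbrev LaurentPoly (K : Type*) [Field K] (l : ℕ) : Type _ :=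
  AddMonoidAlgebra K (Fin l → ℤ)

namespace LaurentPoly

variable {K : Type*} [Field K] {l : ℕ}

/-- The constant Laurent polynomial `c`. -/
def C (c : K) : LaurentPoly K l := AddMonoidAlgebra.single 0 c

/-- The Laurent monomial `x_i ^ n`, for an integer `n`. -/
def X (i : Fin l) (n : ℤ) : LaurentPoly K l := AddMonoidAlgebra.single (Pi.single i n) 1

/-- The support of a Laurent polynomial: the exponents whose coefficient is nonzero. -/
def support (f : LaurentPoly K l) : Set (Fin l → ℤ) := {a | f.coeff a ≠ 0}

/-- The Newton polytope: the convex hull in `ℝ^l` of the support. -/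
def newton (f : LaurentPoly K l) : Set (Fin l → ℝ) :=
  convexHull ℝ ((fun (a : Fin l → ℤ) (i : Fin l) => (a i : ℝ)) '' f.support)

end LaurentPoly

/-- The `i`-th Laurent polynomial of the homogeneous Einstein equations,
`b_i / (2 x_i) - 1 / (4 d_i) * ∑_{j,k} L_{ijk} (2 x_k ^ 2 - x_i ^ 2) / (x_i x_j x_k) - 1`. -/
def einsteinPoly {K : Type*} [Field K] {l : ℕ} (b d : Fin l → K) (L : Fin l → Fin l → Fin l → K)
    (i : Fin l) : LaurentPoly K l :=
  LaurentPoly.C (b i / 2) * LaurentPoly.X i (-1)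
    - LaurentPoly.C (1 / (4 * d i)) *
        ∑ j : Fin l, ∑ k : Fin l, LaurentPoly.C (L i j k) *
          ((LaurentPoly.C 2 * LaurentPoly.X k 2 - LaurentPoly.X i 2) *
            (LaurentPoly.X i (-1) * LaurentPoly.X j (-1) * LaurentPoly.X k (-1)))
    - 1

/-- `m` is the mixed volume of `P_1, …, P_l ⊆ ℝ^l`: the `l`-dimensional volume of the Minkowski
sum `t_1 P_1 + ⋯ + t_l P_l` is a polynomial function of `t_1, …, t_l > 0`, and the coefficient of
`t_1 ⋯ t_l` in this polynomial is `m`. -/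
def IsMixedVolume {l : ℕ} (P : Fin l → Set (Fin l → ℝ)) (m : ℝ) : Prop :=
  ∃ p : MvPolynomial (Fin l) ℝ,
    (∀ t : Fin l → ℝ, (∀ i, 0 < t i) →
      volume.real (∑ i, t i • P i) = MvPolynomial.eval t p) ∧
    p.coeff (Finsupp.equivFunOnFinite.symm fun _ => 1) = m

/-- The mixed volume is unique, since a polynomial is determined by its values on the
positive orthant. -/
theorem IsMixedVolume.unique {l : ℕ} {P : Fin l → Set (Fin l → ℝ)} {m m' : ℝ}
    (h : IsMixedVolume P m) (h' : IsMixedVolume P m') : m = m' := by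
  obtain ⟨p, hp, rfl⟩ := h
  obtain ⟨q, hq, rfl⟩ := h'
  have : p = q := by
    refine MvPolynomial.funext_set (fun _ => Set.Ioi (0 : ℝ)) (fun _ => Set.Ioi_infinite 0) ?_
    intro t ht
    have ht' : ∀ i, 0 < t i := fun i => ht i (Set.mem_univ i)
    rw [← hp t ht', ← hq t ht']
  rw [this]

/-- The polytope `conv (0, e_i - 2 e_j : i, j)` in `ℝ^l`. -/
def einsteinPolytope (l : ℕ) : Set (Fin l → ℝ) :=
  convexHull ℝ (insert 0 (Set.range fun p : Fin l × Fin l =>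
    (Pi.single p.1 (1 : ℝ) - 2 • Pi.single p.2 (1 : ℝ) : Fin l → ℝ)))

/-- The normalized volume `l! Vol(P)` of `P ⊆ ℝ^l`. -/
def normalizedVolume {l : ℕ} (P : Set (Fin l → ℝ)) : ℝ := (l ! : ℝ) * volume.real P

end

/-!
The polytopes `Newt(f_i)` all lie in the polytope `P = conv (0, e_i - 2 e_j)`, and the mixed volume
of `l` copies of `P` is `l! Vol(P)` (`isMixedVolume_const`). So the theorem is an instance of the
equality case of the monotonicity of mixed volumes, which is proved with regular mixed subdivisions.

Give every point `a` of colour `i`, that is every candidate exponent of the `i`-th polytope, the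
Cayley vector `(a, e_i)`. For `t > 0` the Minkowski sum `∑ t_i P_i` is the slice at height `t` of
the cone over the Cayley vectors (`sum_smul_convexHull_eq_cayleySlice`). Heights `ω` on the labels
turn the search for a representation of `(q, t)` as a nonnegative combination into a linear program.
For generic `ω` and almost every `q` its optimal solution is supported on a basis `B` whose
interpolating functional stays below `ω`, and on only one such `B`. Thus the slices of these cells
tile `∑ t_i P_i` (`volume_cayleySlice_eq_sum`). A basis with `n_i` points of colour `i` contributes
a constant times `∏ t_i ^ (n_i - 1)` (`volume_cayleySlice_of_basis`), so the volume is a polynomial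
in `t`, and the mixed volume is the sum of the contributions of the mixed cells, where all `n_i` are
`2` (`isMixedVolume_sum_mixedCells`).

To compare a family of subpolytopes, spanned by the labels in `T`, with the full polytopes, raise
the heights outside `T` by a large `N`. A cell inside `T` remains a cell. If a mixed cell not
contained in `T` persisted for arbitrarily large `N`, the leading coefficient in `N` of its
interpolating functional would be a functional `y` that is at most the indicator of the complement
of `T`, with equality on the cell (`exists_isMixedVolume_subset_and_univ`). For the Einstein
equations the covector part `w` of `y` selects a face of `P`, and either every `Newt(f_i)` meets
this face, which forces the cell into `T`, or the Cayley vectors of those colours whose polytopes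
meet the face are too many for the linear subspace in which the face confines them
(`subset_of_functional_le_indicator`).
-/

/-! ### Regular triangulations of a vector configuration -/

section Triangulation

variable {τ E : Type*} [Fintype τ] [AddCommGroup E] [Module ℝ E]

/-- The ways of writing `x` as a nonnegative combination of the vectors `a v`, `v ∈ S`. -/
def conicWeights (a : τ → E) (S : Set τ) (x : E) : Set (τ → ℝ) :=
  {w | (∀ v, 0 ≤ w v) ∧ (∀ v, v ∉ S → w v = 0) ∧ ∑ v, w v • a v = x}

/-- A height function is generic if every linearly dependent subfamily satisfies a linear relation
that the heights violate. -/
def IsGenericHeight (a : τ → E) (ω : τ → ℝ) : Prop :=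
  ∀ S : Set τ, ¬ LinearIndepOn ℝ a S →
    ∃ μ : τ → ℝ, (∀ v, v ∉ S → μ v = 0) ∧ ∑ v, μ v • a v = 0 ∧ ∑ v, μ v * ω v ≠ 0

/-- The full-dimensional cells of the subdivision of the cone over `a v`, `v ∈ T`, induced by the
heights `ω`: the index sets `B` of bases such that the linear functional interpolating the heights
on `B` lies below the heights on all of `T`. -/
structure IsRegularCell (a : τ → E) (ω : τ → ℝ) (T B : Set τ) : Prop where
  subset : B ⊆ T
  linearIndepOn : LinearIndepOn ℝ a B
  span_eq_top : Submodule.span ℝ (a '' B) = ⊤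
  exists_functional : ∃ y : E →ₗ[ℝ] ℝ, (∀ v ∈ B, y (a v) = ω v) ∧ ∀ v ∈ T, y (a v) ≤ ω v

variable {a : τ → E} {ω : τ → ℝ} {S T B B' : Set τ} {x : E}

lemma exists_relation_of_not_linearIndepOn (h : ¬ LinearIndepOn ℝ a S) :
    ∃ μ : τ → ℝ, (∀ v, v ∉ S → μ v = 0) ∧ ∑ v, μ v • a v = 0 ∧ ∃ v, μ v ≠ 0 := by
  classical
  have hS : ((S.toFinset : Finset τ) : Set τ) = S := by simp
  rw [← hS, linearIndepOn_finset_iff] at h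
  push Not at h
  obtain ⟨g, hg, i, hi, hgi⟩ := h
  refine ⟨fun v => if v ∈ S then g v else 0, fun v hv => by simp [hv], ?_, i, ?_⟩
  · rw [← hg]
    simp [ite_smul, Finset.sum_ite, Set.filter_mem_univ_eq_toFinset]
  · have : i ∈ S := by simpa using hi
    simpa [this] using hgi

lemma exists_isGenericHeight (a : τ → E) : ∃ ω, IsGenericHeight a ω := by
  classical
  choose! μ hμ using fun (S : Set τ) (h : ¬ LinearIndepOn ℝ a S) =>
    exists_relation_of_not_linearIndepOn h
  let f : {S : Set τ // ¬ LinearIndepOn ℝ a S} → Module.Dual ℝ (τ → ℝ) := fun S =>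
    ∑ v, μ S v • LinearMap.proj v
  have hf : ∀ S ω, f S ω = ∑ v, μ S v * ω v := fun S ω => by simp [f]
  obtain ⟨ω, hω⟩ := Module.Dual.exists_forall_ne_zero_of_forall_exists f (fun S => by
    obtain ⟨v, hv⟩ := (hμ S S.2).2.2
    exact ⟨Pi.single v 1, by simpa [hf, Pi.single_apply] using hv⟩)
  exact ⟨ω, fun S hS => ⟨μ S, (hμ S hS).1, (hμ S hS).2.1, by simpa [hf] using hω ⟨S, hS⟩⟩⟩

lemma eventually_add_mul_ne_zero {r : ℝ} (hr : r ≠ 0) (s : ℝ) :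
    ∀ᶠ N : ℝ in Filter.atTop, r + N * s ≠ 0 := by
  filter_upwards [Filter.eventually_gt_atTop (-r / s)] with N hN h
  rcases eq_or_ne s 0 with rfl | hs
  · simp_all
  · exact hN.ne' (by field_simp; linarith)

lemma IsGenericHeight.eventually_add_smul (h : IsGenericHeight a ω) (δ : τ → ℝ) :
    ∀ᶠ N : ℝ in Filter.atTop, IsGenericHeight a (ω + N • δ) := by
  choose! μ hμ using h
  have : ∀ᶠ N : ℝ in Filter.atTop, ∀ S : Set τ, ¬ LinearIndepOn ℝ a S →
      ∑ v, μ S v * ω v + N * ∑ v, μ S v * δ v ≠ 0 := by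
    rw [Filter.eventually_all]
    intro S
    by_cases hS : LinearIndepOn ℝ a S
    · simp [hS]
    · simpa [hS] using eventually_add_mul_ne_zero (hμ S hS).2.2 _
  filter_upwards [this] with N hN S hS
  refine ⟨μ S, (hμ S hS).1, (hμ S hS).2.1, ?_⟩
  convert hN S hS using 1
  simp only [Pi.add_apply, Pi.smul_apply, smul_eq_mul, mul_add, Finset.sum_add_distrib,
    Finset.mul_sum]
  congr 1
  exact Finset.sum_congr rfl fun v _ => by ring

lemma exists_weights_of_mem_span (hx : x ∈ Submodule.span ℝ (a '' S)) :
    ∃ m : τ → ℝ, (∀ v, v ∉ S → m v = 0) ∧ ∑ v, m v • a v = x := by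
  induction hx using Submodule.span_induction with
  | mem x hx =>
    classical
    obtain ⟨v, hv, rfl⟩ := hx
    refine ⟨Pi.single v 1, fun u hu => ?_, by simp [Pi.single_apply]⟩
    have huv : u ≠ v := fun h => hu (h ▸ hv)
    simp [huv]
  | zero => exact ⟨0, by simp, by simp⟩
  | add x y _ _ hx hy =>
    obtain ⟨m, hm, rfl⟩ := hx
    obtain ⟨m', hm', rfl⟩ := hy
    exact ⟨m + m', fun v hv => by simp [hm v hv, hm' v hv],
      by simp [add_smul, Finset.sum_add_distrib]⟩
  | smul r x _ hx =>
    obtain ⟨m, hm, rfl⟩ := hx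
    exact ⟨r • m, fun v hv => by simp [hm v hv], by simp [mul_smul, Finset.smul_sum]⟩

lemma mem_span_support {w : τ → ℝ} (hw : ∑ v, w v • a v = x) :
    x ∈ Submodule.span ℝ (a '' {v | w v ≠ 0}) := by
  rw [← hw]
  refine Submodule.sum_mem _ fun v _ => ?_
  by_cases hv : w v = 0
  · simp [hv]
  · exact Submodule.smul_mem _ _ (Submodule.subset_span ⟨v, hv, rfl⟩)

/-- A subfamily of a generic lifting on which the heights are linear is independent. -/
lemma IsGenericHeight.linearIndepOn (h : IsGenericHeight a ω) (y : E →ₗ[ℝ] ℝ)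
    (hy : ∀ v ∈ S, y (a v) = ω v) : LinearIndepOn ℝ a S := by
  by_contra hS
  obtain ⟨μ, hμS, hμ, hne⟩ := h S hS
  apply hne
  have := congrArg y hμ
  rw [map_sum, map_zero] at this
  rw [← this]
  refine Finset.sum_congr rfl fun v _ => ?_
  by_cases hv : v ∈ S
  · simp [hy v hv]
  · simp [hμS v hv]

omit [Fintype τ] in
lemma exists_functional_eqOn (hB : LinearIndepOn ℝ a B) (ω : τ → ℝ) :
    ∃ y : E →ₗ[ℝ] ℝ, ∀ v ∈ B, y (a v) = ω v := by
  let β := Module.Basis.span hB.linearIndependent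
  obtain ⟨y, hy⟩ := LinearMap.exists_extend (β.constr ℝ fun v => ω v)
  refine ⟨y, fun v hv => ?_⟩
  have h1 : (β ⟨v, hv⟩ : E) = a v :=
    congrArg Subtype.val (Module.Basis.span_apply hB.linearIndependent ⟨v, hv⟩)
  have h2 := LinearMap.congr_fun hy (β ⟨v, hv⟩)
  rw [LinearMap.comp_apply, Module.Basis.constr_basis, Submodule.subtype_apply, h1] at h2
  exact h2

omit [Fintype τ] in
lemma eq_of_subset_of_linearIndepOn (hBS : B ⊆ S) (hS : LinearIndepOn ℝ a S)
    (hB : Submodule.span ℝ (a '' B) = ⊤) : B = S := by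
  refine hBS.antisymm fun v hv => ?_
  have hv' : a v ∈ Submodule.span ℝ (a '' B) := hB ▸ Submodule.mem_top
  exact (hS.mono hBS).mem_span_iff.mp hv' (hS.mono (Set.insert_subset hv hBS))

/-- A vector is in general position if it lies in no proper subspace spanned by vectors `a v`. -/
def IsGeneralPoint (a : τ → E) (x : E) : Prop :=
  ∀ S : Set τ, x ∈ Submodule.span ℝ (a '' S) → Submodule.span ℝ (a '' S) = ⊤

/-- The coordinates of a vector in general position with respect to a basis do not vanish. -/
lemma IsGeneralPoint.support_eq (hx : IsGeneralPoint a x) (hB : LinearIndepOn ℝ a B) {w : τ → ℝ}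
    (hw : w ∈ conicWeights a B x) : {v | w v ≠ 0} = B :=
  eq_of_subset_of_linearIndepOn (fun v hv => by_contra fun h => hv (hw.2.1 v h)) hB
    (hx _ (mem_span_support hw.2.2))

lemma map_eq_sum_mul {w : τ → ℝ} (hw : w ∈ conicWeights a S x) (y : E →ₗ[ℝ] ℝ) :
    y x = ∑ v, w v * y (a v) := by
  rw [← hw.2.2]; simp

/-- Comparing costs: a vector in general position lies in at most one cell. -/
lemma IsRegularCell.eq_of_mem (hω : IsGenericHeight a ω) (hx : IsGeneralPoint a x)
    (hB : IsRegularCell a ω T B) (hB' : IsRegularCell a ω T B') {w w' : τ → ℝ}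
    (hw : w ∈ conicWeights a B x) (hw' : w' ∈ conicWeights a B' x) : B = B' := by
  -- the cost of `w` equals `y x`, that of `w'` is at least `y x`, and symmetrically
  have key : ∀ {B B' : Set τ} {w w' : τ → ℝ}, IsRegularCell a ω T B → IsRegularCell a ω T B' →
      w ∈ conicWeights a B x → w' ∈ conicWeights a B' x →
      ∑ v, w v * ω v ≤ ∑ v, w' v * ω v := by
    intro B B' w w' hB hB' hw hw'
    obtain ⟨y, hyB, hyT⟩ := hB.exists_functional
    have h1 : ∑ v, w v * ω v = y x := by
      rw [map_eq_sum_mul hw]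
      refine Finset.sum_congr rfl fun v _ => ?_
      by_cases hv : v ∈ B
      · rw [hyB v hv]
      · simp [hw.2.1 v hv]
    rw [h1, map_eq_sum_mul hw']
    refine Finset.sum_le_sum fun v _ => ?_
    by_cases hv : v ∈ B'
    · exact mul_le_mul_of_nonneg_left (hyT v (hB'.subset hv)) (hw'.1 v)
    · simp [hw'.2.1 v hv]
  have hcost := le_antisymm (key hB hB' hw hw') (key hB' hB hw' hw)
  obtain ⟨y, hyB, hyT⟩ := hB.exists_functional
  have hle : ∀ v ∈ (Finset.univ : Finset τ), w' v * y (a v) ≤ w' v * ω v := by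
    intro v _
    by_cases hv : v ∈ B'
    · exact mul_le_mul_of_nonneg_left (hyT v (hB'.subset hv)) (hw'.1 v)
    · simp [hw'.2.1 v hv]
  have hsum : ∑ v, w' v * y (a v) = ∑ v, w' v * ω v := by
    rw [← map_eq_sum_mul hw', ← hcost, map_eq_sum_mul hw]
    refine Finset.sum_congr rfl fun v _ => ?_
    by_cases hv : v ∈ B
    · rw [hyB v hv]
    · simp [hw.2.1 v hv]
  have hterm := (Finset.sum_eq_sum_iff_of_le hle).mp hsum
  have hyB' : ∀ v ∈ B', y (a v) = ω v := by
    intro v hv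
    rw [← hx.support_eq hB'.linearIndepOn hw'] at hv
    exact mul_left_cancel₀ hv (hterm v (Finset.mem_univ v))
  have hind : LinearIndepOn ℝ a (B ∪ B') :=
    hω.linearIndepOn y fun v hv => hv.elim (hyB v) (hyB' v)
  rw [eq_of_subset_of_linearIndepOn Set.subset_union_left hind hB.span_eq_top]
  exact (eq_of_subset_of_linearIndepOn Set.subset_union_right hind hB'.span_eq_top).symm

/-- First-order optimality: a cost-minimizing combination cannot be improved along a relation that
keeps the weights nonnegative. -/
lemma sum_mul_nonneg_of_isMinOn {w ν : τ → ℝ} (hw : w ∈ conicWeights a T x)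
    (hmin : IsMinOn (fun w : τ → ℝ => ∑ v, w v * ω v) (conicWeights a T x) w)
    (hνT : ∀ v, v ∉ T → ν v = 0) (hν : ∑ v, ν v • a v = 0) (hν0 : ∀ v, w v = 0 → 0 ≤ ν v) :
    0 ≤ ∑ v, ν v * ω v := by
  have hev : ∀ᶠ ε : ℝ in nhdsWithin 0 (Set.Ioi 0), ∀ v, 0 ≤ w v + ε * ν v := by
    rw [Filter.eventually_all]
    intro v
    rcases (hw.1 v).eq_or_lt with h | h
    · filter_upwards [self_mem_nhdsWithin] with ε (hε : 0 < ε)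
      have := hν0 v h.symm
      rw [← h]; positivity
    · have hc : Filter.Tendsto (fun ε : ℝ => w v + ε * ν v) (nhdsWithin 0 (Set.Ioi 0))
          (nhds (w v + 0 * ν v)) := by
        apply Filter.Tendsto.mono_left _ nhdsWithin_le_nhds
        exact Continuous.tendsto (by fun_prop) 0
      rw [zero_mul, add_zero] at hc
      exact (hc.eventually (lt_mem_nhds h)).mono fun _ h => h.le
  obtain ⟨ε, hε, hε0 : 0 < ε⟩ := (hev.and self_mem_nhdsWithin).exists
  have hmem : w + ε • ν ∈ conicWeights a T x := by
    refine ⟨hε, fun v hv => by simp [hw.2.1 v hv, hνT v hv], ?_⟩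
    simp only [Pi.add_apply, Pi.smul_apply, smul_eq_mul, add_smul, mul_smul,
      Finset.sum_add_distrib, ← Finset.smul_sum, hw.2.2, hν, smul_zero, add_zero]
  have h := hmin hmem
  simp only [Set.mem_ofPred_eq, Pi.add_apply, Pi.smul_apply, smul_eq_mul, add_mul,
    Finset.sum_add_distrib, mul_assoc, ← Finset.mul_sum] at h
  by_contra hneg
  push Not at hneg
  have := mul_neg_of_pos_of_neg hε0 hneg
  linarith

/-- The support of a cost-minimizing combination is a cell. -/
lemma isRegularCell_of_isMinOn (hω : IsGenericHeight a ω) (hx : IsGeneralPoint a x) {w : τ → ℝ}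
    (hw : w ∈ conicWeights a T x)
    (hmin : IsMinOn (fun w : τ → ℝ => ∑ v, w v * ω v) (conicWeights a T x) w) :
    IsRegularCell a ω T {v | w v ≠ 0} := by
  classical
  have hsub : {v | w v ≠ 0} ⊆ T := fun v hv => by_contra fun h => hv (hw.2.1 v h)
  have hspan := hx _ (mem_span_support hw.2.2)
  have hind : LinearIndepOn ℝ a {v | w v ≠ 0} := by
    by_contra hdep
    obtain ⟨μ, hμ, hμa, hne⟩ := hω _ hdep
    have hμT : ∀ v, v ∉ T → μ v = 0 := fun v hv => hμ v fun h => hv (hsub h)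
    have h1 := sum_mul_nonneg_of_isMinOn hw hmin hμT hμa
      fun v hv => (hμ v (by simpa using hv)).ge
    have h2 := sum_mul_nonneg_of_isMinOn (ν := -μ) hw hmin (by simpa using hμT)
      (by simpa using hμa) fun v hv => by simp [hμ v (by simpa using hv)]
    simp only [Pi.neg_apply, neg_mul, Finset.sum_neg_distrib] at h2
    exact hne (by linarith)
  refine ⟨hsub, hind, hspan, ?_⟩
  obtain ⟨y, hy⟩ := exists_functional_eqOn hind ω
  refine ⟨y, hy, fun v hv => ?_⟩
  by_cases hwv : w v ≠ 0
  · exact (hy v hwv).le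
  -- push along the relation expressing `a v` in the basis
  push Not at hwv
  obtain ⟨m, hm, hmv⟩ := exists_weights_of_mem_span (hspan ▸ Submodule.mem_top :
    a v ∈ Submodule.span ℝ (a '' {v | w v ≠ 0}))
  have hym : y (a v) = ∑ u, m u * ω u := by
    rw [← hmv, map_sum]
    refine Finset.sum_congr rfl fun u _ => ?_
    by_cases hu : w u ≠ 0
    · rw [map_smul, hy u hu, smul_eq_mul]
    · simp [hm u hu]
  have h := sum_mul_nonneg_of_isMinOn (ν := Pi.single v 1 - m) hw hmin ?_ ?_ ?_
  · simp only [Pi.sub_apply, sub_mul, Finset.sum_sub_distrib, ← hym] at h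
    simpa [Pi.single_apply] using h
  · intro u hu
    have huv : u ≠ v := fun h => hu (h ▸ hv)
    simp [huv, hm u fun h => hu (hsub h)]
  · simp only [Pi.sub_apply, sub_smul, Finset.sum_sub_distrib, hmv]
    simp [Pi.single_apply]
  · intro u hu
    simp only [Pi.sub_apply, hm u (by simpa using hu), sub_zero, Pi.single_apply]
    split_ifs <;> norm_num

end Triangulation

/-! ### The Cayley trick -/

section Cayley

variable {κ ι τ : Type*} [Fintype τ] [DecidableEq ι]

/-- The Cayley embedding of a point `p v` of colour `c v`: the point, followed by the standard
basis vector of its colour. -/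
def cayley (c : τ → ι) (p : τ → κ → ℝ) (v : τ) : κ ⊕ ι → ℝ :=
  Sum.elim (p v) (Pi.single (c v) 1)

/-- The slice at height `t` of the cone over the Cayley vectors indexed by `S`. For positive `t` it
is the Minkowski sum of the dilates by `t i` of the convex hulls of the points of colour `i`. -/
def cayleySlice (c : τ → ι) (p : τ → κ → ℝ) (S : Set τ) (t : ι → ℝ) : Set (κ → ℝ) :=
  {q | (conicWeights (cayley c p) S (Sum.elim q t)).Nonempty}

variable {c : τ → ι} {p : τ → κ → ℝ} {S : Set τ} {t : ι → ℝ}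

lemma sum_smul_cayley_eq_iff {w : τ → ℝ} {q : κ → ℝ} :
    ∑ v, w v • cayley c p v = Sum.elim q t ↔
      ∑ v, w v • p v = q ∧ ∀ i, ∑ v with c v = i, w v = t i := by
  simp only [funext_iff, Sum.forall, Finset.sum_apply, Pi.smul_apply, cayley, Sum.elim_inl,
    Sum.elim_inr, smul_eq_mul, Finset.sum_filter, Pi.single_apply, mul_ite, mul_one, mul_zero]
  simp only [eq_comm]

lemma convex_cayleySlice : Convex ℝ (cayleySlice c p S t) := by
  rintro q ⟨w, hw⟩ q' ⟨w', hw'⟩ r s hr hs hrs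
  refine ⟨r • w + s • w', fun v => ?_, fun v hv => ?_, ?_⟩
  · have := hw.1 v; have := hw'.1 v
    simp only [Pi.add_apply, Pi.smul_apply, smul_eq_mul]; positivity
  · simp [hw.2.1 v hv, hw'.2.1 v hv]
  · have h : Sum.elim (r • q + s • q') t = r • Sum.elim q t + s • Sum.elim q' t := by
      ext (k | i)
      · simp
      · simp [← add_mul, hrs]
    simp [h, ← hw.2.2, ← hw'.2.2, add_smul, mul_smul, Finset.sum_add_distrib, Finset.smul_sum]

lemma cayleySlice_mono {S S' : Set τ} (h : S ⊆ S') :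
    cayleySlice c p S t ⊆ cayleySlice c p S' t :=
  fun _ ⟨w, hw⟩ => ⟨w, hw.1, fun v hv => hw.2.1 v fun h' => hv (h h'), hw.2.2⟩

lemma conicWeights_cayley_subset_Icc {q : κ → ℝ} :
    conicWeights (cayley c p) S (Sum.elim q t) ⊆ Set.Icc 0 (t ∘ c) := by
  intro w hw
  refine ⟨hw.1, fun v => ?_⟩
  rw [Function.comp_apply, ← (sum_smul_cayley_eq_iff.mp hw.2.2).2 (c v)]
  exact Finset.single_le_sum (f := w) (fun u _ => hw.1 u) (by simp)

lemma isCompact_conicWeights_cayley (q : κ → ℝ) :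
    IsCompact (conicWeights (cayley c p) S (Sum.elim q t)) := by
  refine isCompact_Icc.of_isClosed_subset ?_ conicWeights_cayley_subset_Icc
  refine (isClosed_le continuous_const continuous_id).inter (IsClosed.inter ?_ ?_)
  · change IsClosed {w : τ → ℝ | ∀ v, v ∉ S → w v = 0}
    simp only [Set.ofPred_forall]
    exact isClosed_iInter fun v => isClosed_iInter fun _ =>
      isClosed_eq (continuous_apply v) continuous_const
  · exact isClosed_eq (by fun_prop) continuous_const

lemma isBounded_cayleySlice [Fintype κ] : Bornology.IsBounded (cayleySlice c p S t) := by
  have hc : IsCompact ((fun w : τ → ℝ => ∑ v, w v • p v) '' Set.Icc 0 (t ∘ c)) :=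
    isCompact_Icc.image (by fun_prop)
  refine hc.isBounded.subset ?_
  rintro q ⟨w, hw⟩
  exact ⟨w, conicWeights_cayley_subset_Icc hw, (sum_smul_cayley_eq_iff.mp hw.2.2).1⟩

omit [DecidableEq ι] in
lemma mem_convexHull_image_iff_exists_weights {E : Type*} [AddCommGroup E] [Module ℝ E]
    {p : τ → E} {x : E} : x ∈ convexHull ℝ (p '' S) ↔
      ∃ w : τ → ℝ, (∀ v, 0 ≤ w v) ∧ (∀ v, v ∉ S → w v = 0) ∧ ∑ v, w v = 1 ∧
        ∑ v, w v • p v = x := by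
  classical
  constructor
  · intro hx
    refine convexHull_min (t := {x | ∃ w : τ → ℝ, (∀ v, 0 ≤ w v) ∧ (∀ v, v ∉ S → w v = 0) ∧
      ∑ v, w v = 1 ∧ ∑ v, w v • p v = x}) ?_ ?_ hx
    · rintro _ ⟨v, hv, rfl⟩
      refine ⟨Pi.single v 1, fun u => ?_, fun u hu => ?_, by simp, by simp [Pi.single_apply]⟩
      · rw [Pi.single_apply]; split_ifs <;> norm_num
      · have : u ≠ v := fun h => hu (h ▸ hv)
        simp [this]
    · rintro _ ⟨w, hw0, hwS, hw1, rfl⟩ _ ⟨w', hw0', hwS', hw1', rfl⟩ r s hr hs hrs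
      refine ⟨r • w + s • w', fun v => ?_, fun v hv => by simp [hwS v hv, hwS' v hv], ?_, ?_⟩
      · have := hw0 v; have := hw0' v
        simp only [Pi.add_apply, Pi.smul_apply, smul_eq_mul]; positivity
      · simp [Finset.sum_add_distrib, ← Finset.mul_sum, hw1, hw1', hrs]
      · simp [add_smul, mul_smul, Finset.sum_add_distrib, Finset.smul_sum]
  · rintro ⟨w, hw0, hwS, hw1, rfl⟩
    have h1 : ∑ v with v ∈ S, w v = ∑ v, w v :=
      Finset.sum_subset (Finset.subset_univ _) fun v _ hv => hwS v (by simpa using hv)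
    have h2 : ∑ v with v ∈ S, w v • p v = ∑ v, w v • p v :=
      Finset.sum_subset (Finset.subset_univ _) fun v _ hv => by
        rw [hwS v (by simpa using hv), zero_smul]
    rw [← h2]
    exact (convex_convexHull ℝ _).sum_mem (fun v _ => hw0 v) (h1.trans hw1) fun v hv =>
      subset_convexHull ℝ _ ⟨v, by simpa using hv, rfl⟩

lemma sum_smul_convexHull_eq_cayleySlice [Fintype ι] (ht : ∀ i, 0 < t i) :
    ∑ i, t i • convexHull ℝ (p '' {v | v ∈ S ∧ c v = i}) = cayleySlice c p S t := by
  ext q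
  rw [Set.mem_fintype_sum]
  constructor
  · rintro ⟨g, hg, rfl⟩
    choose y hy hyg using fun i => Set.mem_smul_set.mp (hg i)
    choose w hw0 hwS hw1 hwy using fun i => mem_convexHull_image_iff_exists_weights.mp (hy i)
    refine ⟨fun v => t (c v) * w (c v) v, fun v => mul_nonneg (ht _).le (hw0 _ _), fun v hv => ?_,
      sum_smul_cayley_eq_iff.mpr ⟨?_, fun i => ?_⟩⟩
    · simp [hwS (c v) v fun h => hv h.1]
    · rw [← Finset.sum_fiberwise Finset.univ c]
      refine Finset.sum_congr rfl fun i _ => ?_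
      rw [← hyg i, ← hwy i, Finset.smul_sum]
      refine (Finset.sum_congr rfl fun v hv => ?_).trans
        (Finset.sum_subset (Finset.subset_univ _) fun v _ hv => ?_)
      · rw [(Finset.mem_filter.mp hv).2, mul_smul]
      · rw [hwS i v fun h => hv (by simp [h.2]), zero_smul, smul_zero]
    · rw [← mul_one (t i), ← hw1 i, Finset.mul_sum]
      refine (Finset.sum_congr rfl fun v hv => ?_).trans
        (Finset.sum_subset (Finset.subset_univ _) fun v _ hv => ?_)
      · rw [(Finset.mem_filter.mp hv).2]
      · rw [hwS i v fun h => hv (by simp [h.2]), mul_zero]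
  · rintro ⟨w, hw0, hwS, hw⟩
    obtain ⟨hq, hwt⟩ := sum_smul_cayley_eq_iff.mp hw
    refine ⟨fun i => ∑ v with c v = i, w v • p v, fun i => Set.mem_smul_set.mpr
      ⟨(t i)⁻¹ • ∑ v with c v = i, w v • p v, ?_, smul_inv_smul₀ (ht i).ne' _⟩, ?_⟩
    · refine mem_convexHull_image_iff_exists_weights.mpr
        ⟨fun v => if c v = i then (t i)⁻¹ * w v else 0, fun v => ?_, fun v hv => ?_, ?_, ?_⟩
      · have := hw0 v; have := ht i
        dsimp only
        split_ifs <;> positivity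
      · dsimp only
        split_ifs with h
        · rw [hwS v fun h' => hv ⟨h', h⟩, mul_zero]
        · rfl
      · rw [← Finset.sum_filter, ← Finset.mul_sum, hwt i, inv_mul_cancel₀ (ht i).ne']
      · simp only [ite_smul, zero_smul, mul_smul]
        rw [← Finset.sum_filter, Finset.smul_sum]
    · rw [← hq, ← Finset.sum_fiberwise Finset.univ c]

omit [Fintype τ] in
lemma exists_mem_of_mem_span_cayley {x : κ ⊕ ι → ℝ} {i : ι}
    (hx : x ∈ Submodule.span ℝ (cayley c p '' S)) (hxi : x (Sum.inr i) ≠ 0) :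
    ∃ v ∈ S, c v = i := by
  by_contra! hi
  have : Submodule.span ℝ (cayley c p '' S) ≤
      LinearMap.ker (LinearMap.proj (Sum.inr i) : (κ ⊕ ι → ℝ) →ₗ[ℝ] ℝ) := by
    rw [Submodule.span_le]
    rintro _ ⟨v, hv, rfl⟩
    simp [cayley, (hi v hv).symm]
  exact hxi (this hx)

/-- Almost every point of the slice of a positive height `t` is in general position. -/
lemma volume_not_isGeneralPoint [Fintype κ] [Fintype ι] (c : τ → ι) (p : τ → κ → ℝ)
    (ht : ∀ i, 0 < t i) :
    volume {q : κ → ℝ | ¬ IsGeneralPoint (cayley c p) (Sum.elim q t)} = 0 := by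
  let f : (κ → ℝ) →ᵃ[ℝ] (κ ⊕ ι → ℝ) :=
    { toFun := fun q => Sum.elim q t
      linear :=
        { toFun := fun q => Sum.elim q 0
          map_add' := fun q q' => by ext (k | i) <;> simp
          map_smul' := fun r q => by ext (k | i) <;> simp }
      map_vadd' := fun q q' => by ext (k | i) <;> simp }
  have hsub : {q : κ → ℝ | ¬ IsGeneralPoint (cayley c p) (Sum.elim q t)} ⊆
      ⋃ S : {S : Set τ // Submodule.span ℝ (cayley c p '' S) ≠ ⊤},
        ((Submodule.span ℝ (cayley c p '' S)).toAffineSubspace.comap f : Set (κ → ℝ)) := by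
    intro q hq
    simp only [IsGeneralPoint, Set.mem_ofPred_eq, not_forall] at hq
    obtain ⟨S, hqS, hS⟩ := hq
    exact Set.mem_iUnion.mpr ⟨⟨S, hS⟩, hqS⟩
  refine measure_mono_null hsub (measure_iUnion_null fun ⟨S, hS⟩ => ?_)
  refine Measure.addHaar_affineSubspace _ _ fun htop => hS ?_
  have hmem : ∀ q : κ → ℝ, Sum.elim q t ∈ Submodule.span ℝ (cayley c p '' S) := fun q => by
    have : q ∈ (Submodule.span ℝ (cayley c p '' S)).toAffineSubspace.comap f := by
      rw [htop]; exact AffineSubspace.mem_top _ _ _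
    exact this
  -- all horizontal vectors, hence all colour vectors, lie in the span
  have hhor : ∀ q : κ → ℝ, Sum.elim q 0 ∈ Submodule.span ℝ (cayley c p '' S) := fun q => by
    convert Submodule.sub_mem _ (hmem q) (hmem 0) using 1
    ext (k | i) <;> simp
  have hcol : ∀ i, ∃ v ∈ S, c v = i := fun i =>
    exists_mem_of_mem_span_cayley (hmem 0) (by simpa using (ht i).ne')
  have hvert : ∀ i, Sum.elim (0 : κ → ℝ) (Pi.single i 1) ∈
      Submodule.span ℝ (cayley c p '' S) := fun i => by
    obtain ⟨v, hv, rfl⟩ := hcol i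
    have hvS : cayley c p v ∈ Submodule.span ℝ (cayley c p '' S) :=
      Submodule.subset_span ⟨v, hv, rfl⟩
    convert Submodule.sub_mem _ hvS (hhor (p v)) using 1
    ext (k | i) <;> simp [cayley]
  rw [eq_top_iff]
  intro x _
  have hx : x = Sum.elim (x ∘ Sum.inl) 0 +
      ∑ i, x (Sum.inr i) • Sum.elim (0 : κ → ℝ) (Pi.single i 1) := by
    ext (k | i)
    · simp
    · simp [Finset.sum_apply, Pi.single_apply]
  rw [hx]
  exact Submodule.add_mem _ (hhor _) (Submodule.sum_mem _ fun i _ =>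
    Submodule.smul_mem _ _ (hvert i))

open Classical in
/-- The slices of the cells of a generic regular triangulation tile the slice of the whole cone. -/
lemma volume_cayleySlice_eq_sum [Fintype κ] [Fintype ι] {ω : τ → ℝ} (T : Set τ)
    (hω : IsGenericHeight (cayley c p) ω) (ht : ∀ i, 0 < t i) :
    volume.real (cayleySlice c p T t) =
      ∑ B with IsRegularCell (cayley c p) ω T B, volume.real (cayleySlice c p B t) := by
  have hnull := volume_not_isGeneralPoint c p ht
  have hfin : ∀ S, volume (cayleySlice c p S t) ≠ ⊤ := fun S =>
    isBounded_cayleySlice.measure_lt_top.ne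
  have hae : cayleySlice c p T t =ᵐ[volume]
      ⋃ B ∈ Finset.univ.filter (IsRegularCell (cayley c p) ω T), cayleySlice c p B t := by
    refine Filter.EventuallyLE.antisymm ?_ (LE.le.eventuallyLE ?_)
    · have hgen : ∀ᵐ q : κ → ℝ, IsGeneralPoint (cayley c p) (Sum.elim q t) := hnull
      filter_upwards [hgen] with q hq hqT
      obtain ⟨w, hw, hmin⟩ := (isCompact_conicWeights_cayley q).exists_isMinOn hqT
        (f := fun w : τ → ℝ => ∑ v, w v * ω v) (by fun_prop)
      refine Set.mem_biUnion (x := {v | w v ≠ 0}) ?_ ⟨w, hw.1, by simp, hw.2.2⟩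
      simpa using isRegularCell_of_isMinOn hω hq hw hmin
    · refine Set.iUnion₂_subset fun B hB => cayleySlice_mono ?_
      exact (Finset.mem_filter.mp hB).2.subset
  rw [measureReal_congr hae, measureReal_biUnion_finset₀ (h := fun B _ => hfin B)]
  · intro B hB B' hB' hne
    refine measure_mono_null ?_ hnull
    rintro q ⟨⟨w, hw⟩, ⟨w', hw'⟩⟩ hq
    refine hne (IsRegularCell.eq_of_mem (T := T) hω hq ?_ ?_ hw hw')
    · exact (Finset.mem_filter.mp hB).2
    · exact (Finset.mem_filter.mp hB').2
  · exact fun B _ => convex_cayleySlice.nullMeasurableSet _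

end Cayley

/-! ### Volumes of simplicial slices -/

section CellVolume

variable {κ ι τ : Type*} [Fintype κ] [Fintype ι] [Fintype τ] [DecidableEq ι]
variable {c : τ → ι} {p : τ → κ → ℝ} {B : Set τ} {t : ι → ℝ}

omit [Fintype κ] [Fintype ι] [Fintype τ] in
lemma exists_mem_of_span_cayley_eq_top (hB : Submodule.span ℝ (cayley c p '' B) = ⊤) (i : ι) :
    ∃ v ∈ B, c v = i := by
  exact exists_mem_of_mem_span_cayley (x := fun _ => 1) (hB ▸ Submodule.mem_top) one_ne_zero

/-- The number of elements of colour `i` in `B`. -/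
noncomputable def colorCount (c : τ → ι) (B : Set τ) (i : ι) : ℕ := {v | v ∈ B ∧ c v = i}.ncard

omit [Fintype κ] [Fintype ι] in
lemma colorCount_pos (hB : Submodule.span ℝ (cayley c p '' B) = ⊤) (i : ι) :
    0 < colorCount c B i := by
  obtain ⟨v, hv⟩ := exists_mem_of_span_cayley_eq_top hB i
  exact (Set.ncard_pos (Set.toFinite _)).mpr ⟨v, hv⟩

/-- Rescaling the basis vectors of colour `i` by `t i` maps the slice at height `1` affinely onto
the slice at height `t`; the determinant is read off the block-triangular matrix. -/
lemma volume_cayleySlice_of_basis (hB : LinearIndepOn ℝ (cayley c p) B)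
    (hB' : Submodule.span ℝ (cayley c p '' B) = ⊤) (ht : ∀ i, 0 < t i) :
    volume.real (cayleySlice c p B t) =
      (∏ i, t i ^ (colorCount c B i - 1)) * volume.real (cayleySlice c p B 1) := by
  classical
  let β := Module.Basis.mk hB.linearIndependent (by rw [← Set.image_eq_range]; exact hB'.ge)
  have hβ : ∀ v : B, β v = cayley c p v := fun v => by simp [β]
  let D : (κ ⊕ ι → ℝ) →ₗ[ℝ] (κ ⊕ ι → ℝ) := β.constr ℝ fun v => t (c v) • β v
  have hDβ : ∀ v, D (β v) = t (c v) • β v := fun v => by simp [D]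
  have hD : ∀ v ∈ B, D (cayley c p v) = t (c v) • cayley c p v := fun v hv => by
    have := hDβ ⟨v, hv⟩
    rwa [hβ] at this
  have hDr : ∀ x i, D x (Sum.inr i) = t i * x (Sum.inr i) := by
    intro x i
    have : (LinearMap.proj (Sum.inr i) : (κ ⊕ ι → ℝ) →ₗ[ℝ] ℝ) ∘ₗ D =
        t i • (LinearMap.proj (Sum.inr i) : (κ ⊕ ι → ℝ) →ₗ[ℝ] ℝ) := by
      refine β.ext fun v => ?_
      rw [LinearMap.comp_apply, hDβ, hβ]
      simp only [LinearMap.proj_apply, LinearMap.smul_apply,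
        Pi.smul_apply, cayley, Sum.elim_inr, Pi.single_apply, smul_eq_mul]
      split_ifs with h
      · rw [h]
      · simp
    exact LinearMap.congr_fun this x
  let hor : (κ → ℝ) →ₗ[ℝ] (κ ⊕ ι → ℝ) :=
    { toFun := fun q => Sum.elim q 0
      map_add' := fun q q' => by ext (k | i) <;> simp
      map_smul' := fun r q => by ext (k | i) <;> simp }
  let A : (κ → ℝ) →ₗ[ℝ] (κ → ℝ) := LinearMap.funLeft ℝ ℝ Sum.inl ∘ₗ D ∘ₗ hor
  let r : κ → ℝ := D (Sum.elim (0 : κ → ℝ) (1 : ι → ℝ)) ∘ Sum.inl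
  have hDq : ∀ q : κ → ℝ, D (Sum.elim q 1) = Sum.elim (A q + r) t := by
    intro q
    have hq : (Sum.elim q 1 : κ ⊕ ι → ℝ) = hor q + Sum.elim (0 : κ → ℝ) (1 : ι → ℝ) := by
      ext (k | i) <;> simp [hor]
    ext (k | i)
    · rw [hq, map_add]; simp [A, r]
    · simp [hDr]
  have himage : cayleySlice c p B t = (fun x => x + r) '' (A '' cayleySlice c p B 1) := by
    rw [Set.image_image]
    ext q
    constructor
    · rintro ⟨w, hw0, hwB, hw⟩
      have hw' : ∑ v, ((t (c v))⁻¹ * w v) • cayley c p v =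
          Sum.elim (∑ v, ((t (c v))⁻¹ * w v) • p v) 1 := by
        refine sum_smul_cayley_eq_iff.mpr ⟨rfl, fun i => ?_⟩
        rw [Pi.one_apply, ← inv_mul_cancel₀ (ht i).ne']
        conv_rhs => rw [← (sum_smul_cayley_eq_iff.mp hw).2 i]
        rw [Finset.mul_sum, (sum_smul_cayley_eq_iff.mp hw).2 i]
        exact Finset.sum_congr rfl fun v hv => by rw [(Finset.mem_filter.mp hv).2]
      refine ⟨_, ⟨fun v => (t (c v))⁻¹ * w v, fun v => ?_, fun v hv => by simp [hwB v hv], hw'⟩, ?_⟩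
      · have := hw0 v; have := ht (c v); dsimp only; positivity
      · have h := hDq (∑ v, ((t (c v))⁻¹ * w v) • p v)
        rw [← hw', map_sum] at h
        have h2 : ∑ v, D (((t (c v))⁻¹ * w v) • cayley c p v) = Sum.elim q t := by
          rw [← hw]
          refine Finset.sum_congr rfl fun v _ => ?_
          by_cases hv : v ∈ B
          · rw [map_smul, hD v hv, smul_smul, mul_comm, mul_inv_cancel_left₀ (ht _).ne']
          · simp [hwB v hv]
        rw [h2] at h
        ext k
        exact (congrFun h (Sum.inl k)).symm
    · rintro ⟨q, ⟨w, hw0, hwB, hw⟩, rfl⟩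
      refine ⟨fun v => t (c v) * w v, fun v => mul_nonneg (ht _).le (hw0 v),
        fun v hv => by simp [hwB v hv], ?_⟩
      rw [← hDq, ← hw, map_sum]
      refine Finset.sum_congr rfl fun v _ => ?_
      by_cases hv : v ∈ B
      · rw [map_smul, hD v hv, smul_smul, mul_comm]
      · simp [hwB v hv]
  have hdetD : LinearMap.det D = ∏ i, t i ^ colorCount c B i := by
    have hdiag : LinearMap.toMatrix β β D = Matrix.diagonal fun v : B => t (c v) := by
      ext u v
      rw [LinearMap.toMatrix_apply, hDβ, map_smul, β.repr_self, Matrix.diagonal_apply]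
      simp only [Finsupp.smul_apply, Finsupp.single_apply, smul_eq_mul, mul_ite, mul_one, mul_zero]
      by_cases h : u = v
      · simp [h]
      · simp [h, Ne.symm h]
    rw [← LinearMap.det_toMatrix β, hdiag, Matrix.det_diagonal,
      ← Finset.prod_fiberwise Finset.univ (fun v : B => c v)]
    refine Finset.prod_congr rfl fun i _ => ?_
    rw [Finset.prod_congr rfl fun v hv => by rw [(Finset.mem_filter.mp hv).2],
      Finset.prod_const]
    congr 1
    rw [colorCount, ← Set.ncard_coe_finset, ← Set.ncard_image_of_injective _ Subtype.val_injective]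
    congr 1
    ext v
    simp [and_comm]
  have hdetA : LinearMap.det D = LinearMap.det A * ∏ i, t i := by
    have hblock : LinearMap.toMatrix' D = Matrix.fromBlocks (LinearMap.toMatrix' A)
        (LinearMap.toMatrix' D).toBlocks₁₂ 0 (Matrix.diagonal t) := by
      rw [← Matrix.fromBlocks_toBlocks (LinearMap.toMatrix' D)]
      congr 1
      · ext k k'
        have hs : hor (Pi.single k' 1) = Pi.single (Sum.inl k') 1 := by
          ext (j | i) <;> simp [hor, Pi.single_apply]
        simp only [Matrix.toBlocks₁₁, Matrix.of_apply, LinearMap.toMatrix'_apply, A,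
          LinearMap.comp_apply, LinearMap.funLeft_apply, hs]
      · ext i k
        simp [Matrix.toBlocks₂₁, LinearMap.toMatrix'_apply, hDr]
      · ext i j
        simp [Matrix.toBlocks₂₂, LinearMap.toMatrix'_apply, hDr, Matrix.diagonal_apply,
          Pi.single_apply]
    rw [← LinearMap.det_toMatrix', hblock, Matrix.det_fromBlocks_zero₂₁, Matrix.det_diagonal,
      LinearMap.det_toMatrix']
  have hA : LinearMap.det A = ∏ i, t i ^ (colorCount c B i - 1) := by
    refine mul_right_cancel₀ (b := ∏ i, t i) (Finset.prod_ne_zero_iff.mpr fun i _ => (ht i).ne') ?_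
    rw [← hdetA, hdetD, ← Finset.prod_mul_distrib]
    exact Finset.prod_congr rfl fun i _ => (pow_sub_one_mul (colorCount_pos hB' i).ne' _).symm
  rw [himage, Set.image_add_right, measureReal_def, measure_preimage_add_right,
    Measure.addHaar_image_linearMap, ENNReal.toReal_mul, ENNReal.toReal_ofReal (abs_nonneg _), hA,
    abs_of_nonneg (Finset.prod_nonneg fun i _ => pow_nonneg (ht i).le _), measureReal_def]

end CellVolume

/-! ### Mixed volumes as sums over mixed cells -/

section MixedVolume

variable {l : ℕ} {τ : Type*} [Fintype τ] {c : τ → Fin l} {p : τ → Fin l → ℝ} {ω : τ → ℝ}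

/-- The mixed cells: those with exactly two points of each colour. -/
def IsMixedCell (c : τ → Fin l) (p : τ → Fin l → ℝ) (ω : τ → ℝ) (T B : Set τ) : Prop :=
  IsRegularCell (cayley c p) ω T B ∧ ∀ i, colorCount c B i = 2

open Classical in
/-- The tiling makes the volume of the Minkowski sum a polynomial; its multilinear coefficient
collects the mixed cells. -/
theorem isMixedVolume_sum_mixedCells (T : Set τ) (hω : IsGenericHeight (cayley c p) ω) :
    IsMixedVolume (fun i => convexHull ℝ (p '' {v | v ∈ T ∧ c v = i}))
      (∑ B with IsMixedCell c p ω T B, volume.real (cayleySlice c p B 1)) := by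
  refine ⟨∑ B with IsRegularCell (cayley c p) ω T B, MvPolynomial.monomial
    (Finsupp.equivFunOnFinite.symm fun i => colorCount c B i - 1)
    (volume.real (cayleySlice c p B 1)), fun t ht => ?_, ?_⟩
  · rw [sum_smul_convexHull_eq_cayleySlice ht, volume_cayleySlice_eq_sum T hω ht, map_sum]
    refine Finset.sum_congr rfl fun B hB => ?_
    have hB := (Finset.mem_filter.mp hB).2
    rw [volume_cayleySlice_of_basis hB.linearIndepOn hB.span_eq_top ht, MvPolynomial.eval_monomial,
      Finsupp.prod_fintype _ _ (by simp), mul_comm]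
    simp
  · rw [MvPolynomial.coeff_sum]
    have hfilter : Finset.univ.filter (IsMixedCell c p ω T) =
        (Finset.univ.filter (IsRegularCell (cayley c p) ω T)).filter
          fun B => ∀ i, colorCount c B i = 2 := by
      ext B; simp [IsMixedCell]
    rw [hfilter, Finset.sum_filter (fun B => ∀ i, colorCount c B i = 2)]
    refine Finset.sum_congr rfl fun B hB => ?_
    have hpos := colorCount_pos (c := c) (Finset.mem_filter.mp hB).2.span_eq_top
    rw [MvPolynomial.coeff_monomial]
    refine if_congr ?_ rfl rfl
    rw [Equiv.apply_eq_iff_eq, funext_iff]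
    refine forall_congr' fun i => ?_
    have := hpos i
    omega

/-- Raising the points outside `T` does not change the mixed cells, once the raise is large. The
hypothesis says that no limit of the interpolating functionals sees a mixed cell with a point
outside `T`. -/
lemma eventually_isMixedCell_iff (T : Set τ) (ω : τ → ℝ)
    (h : ∀ (B : Set τ) (y : (Fin l ⊕ Fin l → ℝ) →ₗ[ℝ] ℝ), LinearIndepOn ℝ (cayley c p) B →
      (∀ i, colorCount c B i = 2) → (∀ v, y (cayley c p v) ≤ Tᶜ.indicator 1 v) →
      (∀ v ∈ B, y (cayley c p v) = Tᶜ.indicator 1 v) → B ⊆ T) :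
    ∀ᶠ N : ℝ in Filter.atTop, ∀ B,
      IsMixedCell c p (ω + N • Tᶜ.indicator 1) Set.univ B ↔ IsMixedCell c p ω T B := by
  have hlarge : ∀ r s : ℝ, 0 < s → ∀ᶠ N : ℝ in Filter.atTop, r < N * s := fun r s hs =>
    (Filter.tendsto_id.atTop_mul_const hs).eventually_gt_atTop r
  rw [Filter.eventually_all]
  intro B
  have h1 : ∀ᶠ N : ℝ in Filter.atTop,
      IsMixedCell c p (ω + N • Tᶜ.indicator 1) Set.univ B → B ⊆ T := by
    by_cases hB : LinearIndepOn ℝ (cayley c p) B ∧ (∀ i, colorCount c B i = 2) ∧ ¬ B ⊆ T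
    · obtain ⟨hind, hcount, hBT⟩ := hB
      obtain ⟨y₀, hy₀⟩ := exists_functional_eqOn hind ω
      obtain ⟨y₁, hy₁⟩ := exists_functional_eqOn hind (Tᶜ.indicator 1)
      obtain ⟨v, hv⟩ : ∃ v, (Tᶜ.indicator 1 v : ℝ) < y₁ (cayley c p v) := by
        by_contra! hle
        exact hBT (h B y₁ hind hcount hle hy₁)
      filter_upwards [hlarge (ω v - y₀ (cayley c p v)) _ (sub_pos.mpr hv)] with N hN hcell
      obtain ⟨y, hyB, hyT⟩ := hcell.1.exists_functional
      have hy : y = y₀ + N • y₁ := by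
        refine LinearMap.ext_on hcell.1.span_eq_top ?_
        rintro _ ⟨u, hu, rfl⟩
        simp [hyB u hu, hy₀ u hu, hy₁ u hu]
      have := hyT v (Set.mem_univ v)
      simp only [hy, LinearMap.add_apply, LinearMap.smul_apply, Pi.add_apply, Pi.smul_apply,
        smul_eq_mul] at this
      linarith
    · refine Filter.Eventually.of_forall fun N hcell => ?_
      by_contra hBT
      exact hB ⟨hcell.1.linearIndepOn, hcell.2, hBT⟩
  have h2 : ∀ᶠ N : ℝ in Filter.atTop, IsMixedCell c p ω T B →
      IsMixedCell c p (ω + N • Tᶜ.indicator 1) Set.univ B := by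
    by_cases hcell : IsMixedCell c p ω T B
    · obtain ⟨y, hyB, hyT⟩ := hcell.1.exists_functional
      have : ∀ᶠ N : ℝ in Filter.atTop, ∀ v, y (cayley c p v) - ω v < N * 1 :=
        Filter.eventually_all.mpr fun v => hlarge _ 1 one_pos
      filter_upwards [this] with N hN _
      refine ⟨⟨Set.subset_univ B, hcell.1.linearIndepOn, hcell.1.span_eq_top, y, fun v hv => ?_,
        fun v _ => ?_⟩, hcell.2⟩
      · simp [hyB v hv, hcell.1.subset hv]
      · by_cases hv : v ∈ T
        · simpa [hv] using hyT v hv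
        · have := hN v
          simp [hv]
          linarith
    · exact Filter.Eventually.of_forall fun N hc => absurd hc hcell
  filter_upwards [h1, h2] with N h1 h2
  refine ⟨fun hcell => ?_, h2⟩
  have hBT := h1 hcell
  obtain ⟨y, hyB, hyT⟩ := hcell.1.exists_functional
  refine ⟨⟨hBT, hcell.1.linearIndepOn, hcell.1.span_eq_top, y, fun v hv => ?_, fun v hv => ?_⟩,
    hcell.2⟩
  · simpa [hBT hv] using hyB v hv
  · simpa [hv] using hyT v (Set.mem_univ v)

/-- A criterion for the mixed volume of subpolytopes to equal that of the polytopes. -/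
theorem exists_isMixedVolume_subset_and_univ (T : Set τ)
    (h : ∀ (B : Set τ) (y : (Fin l ⊕ Fin l → ℝ) →ₗ[ℝ] ℝ), LinearIndepOn ℝ (cayley c p) B →
      (∀ i, colorCount c B i = 2) → (∀ v, y (cayley c p v) ≤ Tᶜ.indicator 1 v) →
      (∀ v ∈ B, y (cayley c p v) = Tᶜ.indicator 1 v) → B ⊆ T) :
    ∃ m, IsMixedVolume (fun i => convexHull ℝ (p '' {v | v ∈ T ∧ c v = i})) m ∧
      IsMixedVolume (fun i => convexHull ℝ (p '' {v | c v = i})) m := by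
  classical
  obtain ⟨ω, hω⟩ := exists_isGenericHeight (cayley c p)
  obtain ⟨N, hN, hiff⟩ :=
    ((hω.eventually_add_smul (Tᶜ.indicator 1)).and (eventually_isMixedCell_iff T ω h)).exists
  refine ⟨_, isMixedVolume_sum_mixedCells T hω, ?_⟩
  have := isMixedVolume_sum_mixedCells Set.univ hN
  simpa only [hiff, Set.mem_univ, true_and] using this

lemma sum_smul_eq_smul_of_convex {ι E : Type*} [AddCommGroup E] [Module ℝ E] {P : Set E}
    (hP : Convex ℝ P) (hne : P.Nonempty) (s : Finset ι) {t : ι → ℝ} (ht : ∀ i, 0 ≤ t i) :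
    ∑ i ∈ s, t i • P = (∑ i ∈ s, t i) • P := by
  classical
  induction s using Finset.induction_on with
  | empty => simp [Set.zero_smul_set hne]
  | insert i s hi ih =>
    rw [Finset.sum_insert hi, Finset.sum_insert hi, ih,
      hP.add_smul (ht i) (Finset.sum_nonneg fun i _ => ht i)]

lemma coeff_sum_X_pow (l : ℕ) :
    ((∑ i : Fin l, MvPolynomial.X i) ^ l : MvPolynomial (Fin l) ℝ).coeff
      (Finsupp.equivFunOnFinite.symm fun _ => 1) = l ! := by
  rw [MvPolynomial.coeff_sum_X_pow_of_fintype, if_pos (by simp [Finsupp.sum_fintype]),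
    Finsupp.multinomial_eq_of_support_subset (Finset.subset_univ _)]
  simp [Nat.multinomial]

/-- The mixed volume of `l` copies of a convex set is its normalized volume. -/
theorem isMixedVolume_const {P : Set (Fin l → ℝ)} (hP : Convex ℝ P) (hne : P.Nonempty) :
    IsMixedVolume (fun _ => P) (normalizedVolume P) := by
  refine ⟨MvPolynomial.C (volume.real P) * (∑ i : Fin l, MvPolynomial.X i) ^ l, fun t ht => ?_, ?_⟩
  · rw [sum_smul_eq_smul_of_convex hP hne _ fun i => (ht i).le, measureReal_def,
      Measure.addHaar_smul, ENNReal.toReal_mul, ENNReal.toReal_ofReal (abs_nonneg _),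
      abs_of_nonneg (pow_nonneg (Finset.sum_nonneg fun i _ => (ht i).le) _)]
    simp [measureReal_def, mul_comm]
  · rw [MvPolynomial.coeff_C_mul, coeff_sum_X_pow, normalizedVolume, mul_comm]

end MixedVolume

/-! ### The Einstein configuration -/

section Configuration

variable {l : ℕ}

/-- The exponents `e_k - e_i - e_j`. -/
def triExp (k i j : Fin l) : Fin l → ℤ := Pi.single k 1 - Pi.single i 1 - Pi.single j 1

/-- The labelled exponents that can occur in the Einstein equations: `0`, labelled `none`, and
`e_k - e_i - e_j`, labelled `(k, i, j)`. Different labels may name the same exponent. -/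
def einsteinExp : Option (Fin l × Fin l × Fin l) → Fin l → ℤ
  | none => 0
  | some (k, i, j) => triExp k i j

/-- The labelled exponent as a point of `ℝ^l`; the first component of the label, the colour, is the
index of the equation. -/
def einsteinPoint (v : Fin l × Option (Fin l × Fin l × Fin l)) (i : Fin l) : ℝ :=
  einsteinExp v.2 i

lemma convexHull_range_einsteinPoint (i : Fin l) :
    convexHull ℝ (einsteinPoint '' {v | v.1 = i}) = einsteinPolytope l := by
  have hpt : ∀ k a b : Fin l, einsteinPoint (i, some (k, a, b)) =
      (1 / 2 : ℝ) • (Pi.single k 1 - 2 • Pi.single a 1) +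
        (1 / 2 : ℝ) • (Pi.single k 1 - 2 • Pi.single b 1) := by
    intro k a b
    ext j
    simp only [einsteinPoint, einsteinExp, triExp, Pi.sub_apply, Pi.add_apply, Pi.smul_apply,
      Pi.single_apply, smul_eq_mul]
    push_cast
    ring
  refine (convexHull_min ?_ (convex_convexHull ℝ _)).antisymm
    (convexHull_min ?_ (convex_convexHull ℝ _))
  · rintro _ ⟨⟨i', o⟩, rfl : i' = i, rfl⟩
    rcases o with _ | ⟨k, a, b⟩
    · refine subset_convexHull ℝ _ (Or.inl ?_)
      ext j; simp [einsteinPoint, einsteinExp]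
    · rw [hpt]
      have hmem : ∀ j, (Pi.single k 1 - 2 • Pi.single j 1 : Fin l → ℝ) ∈ einsteinPolytope l :=
        fun j => subset_convexHull ℝ _ (Or.inr ⟨(k, j), rfl⟩)
      exact convex_iff_forall_pos.mp (convex_convexHull ℝ _) (hmem a) (hmem b)
        (by norm_num) (by norm_num) (by norm_num)
  · rintro _ (rfl | ⟨⟨k, a⟩, rfl⟩)
    · refine subset_convexHull ℝ _ ⟨(i, none), rfl, ?_⟩
      ext j; simp [einsteinPoint, einsteinExp]
    · refine subset_convexHull ℝ _ ⟨(i, some (k, a, a)), rfl, ?_⟩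
      rw [hpt, ← add_smul]
      norm_num

/-- The facet condition for the Einstein configuration. Write `y` as a covector `w` and constants
`c i`, and let `M` and `m` be the extreme values of `w`. The face of the Einstein polytope where `w`
is maximal meets every polytope unless `0 < M - 2 * m` and `m < M`; in that case it meets those
with index in the union `S` of the two extremal sets. The points of `B` of these colours then lie
in a proper subspace of `ℝ^(S ⊕ S)` although there are `2 * #S` of them. -/
lemma subset_of_functional_le_indicator {T B : Set (Fin l × Option (Fin l × Fin l × Fin l))}
    (h0 : ∀ i, (i, none) ∈ T) (h1 : ∀ i j, i ≠ j → (i, some (i, j, j)) ∈ T)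
    (h2 : ∀ i j, i ≠ j → (i, some (j, i, i)) ∈ T) (h3 : l = 1 → ∀ i, (i, some (i, i, i)) ∈ T)
    (y : (Fin l ⊕ Fin l → ℝ) →ₗ[ℝ] ℝ)
    (hB : LinearIndepOn ℝ (cayley Prod.fst einsteinPoint) B)
    (hcount : ∀ i, colorCount Prod.fst B i = 2)
    (hy : ∀ v, y (cayley Prod.fst einsteinPoint v) ≤ Tᶜ.indicator 1 v)
    (hyB : ∀ v ∈ B, y (cayley Prod.fst einsteinPoint v) = Tᶜ.indicator 1 v) : B ⊆ T := by
  classical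
  by_contra hBT
  obtain ⟨⟨i₀, o₀⟩, hv₀, hvT⟩ := Set.not_subset.mp hBT
  let w : Fin l → ℝ := fun k => y (Pi.single (Sum.inl k) 1)
  let pair : Option (Fin l × Fin l × Fin l) → ℝ := fun o => ∑ k, einsteinExp o k * w k
  have hpair0 : pair none = 0 := by simp [pair, einsteinExp]
  have hpair : ∀ k i j, pair (some (k, i, j)) = w k - w i - w j := fun k i j => by
    simp [pair, einsteinExp, triExp, sub_mul, Finset.sum_sub_distrib, Pi.single_apply]
  have hypair : ∀ i o, y (cayley Prod.fst einsteinPoint (i, o)) =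
      pair o + y (Pi.single (Sum.inr i) 1) := by
    intro i o
    have hdec : cayley Prod.fst einsteinPoint (i, o) =
        ∑ k, (einsteinExp o k : ℝ) • (Pi.single (Sum.inl k) 1 : Fin l ⊕ Fin l → ℝ) +
          Pi.single (Sum.inr i) 1 := by
      ext (k | k) <;> simp [cayley, einsteinPoint, Finset.sum_apply, Pi.single_apply]
    rw [hdec, map_add, map_sum]
    simp [pair, w]
  -- a colour whose polytope touches the face where `w` is maximal
  have touch : ∀ i o, (i, o) ∈ T → (∀ o', pair o' ≤ pair o) →
      ∀ o', (i, o') ∈ B → (i, o') ∈ T ∧ pair o' = pair o := by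
    intro i o ho hmax o' ho'
    have e1 := hy (i, o)
    have e2 := hyB (i, o') ho'
    rw [hypair] at e1 e2
    rw [Set.indicator_of_notMem (by simpa using ho)] at e1
    have e3 := hmax o'
    by_cases hT : (i, o') ∈ T
    · rw [Set.indicator_of_notMem (by simpa using hT)] at e2
      exact ⟨hT, by linarith⟩
    · rw [Set.indicator_of_mem (by simpa using hT)] at e2
      simp only [Pi.one_apply] at e2
      linarith
  have : Nonempty (Fin l) := ⟨i₀⟩
  obtain ⟨kM, hkM⟩ := Finite.exists_max w
  obtain ⟨km, hkm⟩ := Finite.exists_min w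
  have hle : ∀ k i j, pair (some (k, i, j)) ≤ w kM - 2 * w km := fun k i j => by
    rw [hpair]; linarith [hkM k, hkm i, hkm j]
  have hpos : 0 < w kM - 2 * w km := by
    by_contra! hneg
    refine hvT (touch i₀ none (h0 i₀) (fun o' => ?_) o₀ hv₀).1
    rcases o' with _ | ⟨k, i, j⟩
    · rfl
    · rw [hpair0]; exact (hle k i j).trans hneg
  have hmax : ∀ k j, w k = w kM → w j = w km → ∀ o', pair o' ≤ pair (some (k, j, j)) := by
    intro k j hk hj o'
    have : pair (some (k, j, j)) = w kM - 2 * w km := by rw [hpair, hk, hj]; ring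
    rw [this]
    rcases o' with _ | ⟨k, i, j⟩
    · rw [hpair0]; exact hpos.le
    · exact hle k i j
  have hlt : w km < w kM := by
    refine (hkM km).lt_of_ne fun heq => ?_
    have hconst : ∀ k, w k = w kM := fun k => le_antisymm (hkM k) (heq ▸ hkm k)
    have hconst' : ∀ k, w k = w km := fun k => (hconst k).trans heq.symm
    by_cases hl : l = 1
    · exact hvT (touch i₀ _ (h3 hl i₀) (hmax _ _ (hconst _) (hconst' _)) o₀ hv₀).1
    · have : Nontrivial (Fin l) := Fin.nontrivial_iff_two_le.mpr (by have := i₀.pos; omega)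
      obtain ⟨j, hj⟩ := exists_ne i₀
      exact hvT (touch i₀ _ (h1 i₀ j hj.symm) (hmax _ _ (hconst _) (hconst' _)) o₀ hv₀).1
  let S : Finset (Fin l) := Finset.univ.filter fun k => w k = w kM ∨ w k = w km
  have hS : ∀ v ∈ B, v.1 ∈ S → ∃ k i j, v.2 = some (k, i, j) ∧ w k = w kM ∧ w i = w km ∧
      w j = w km := by
    rintro ⟨i, o⟩ hv hi
    have hval : pair o = w kM - 2 * w km := by
      rcases (Finset.mem_filter.mp hi).2 with hi | hi
      · have hne : i ≠ km := fun h => hlt.ne (by rw [← hi, h])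
        rw [(touch i _ (h1 i km hne) (hmax _ _ hi rfl) o hv).2, hpair, hi]; ring
      · have hne : i ≠ kM := fun h => hlt.ne (by rw [← hi, h])
        rw [(touch i _ (h2 i kM hne) (hmax _ _ rfl hi) o hv).2, hpair, hi]; ring
    rcases o with _ | ⟨k, a, b⟩
    · rw [hpair0] at hval; exact absurd hval hpos.ne
    · rw [hpair] at hval
      have := hkM k; have := hkm a; have := hkm b
      exact ⟨k, a, b, rfl, by linarith, by linarith, by linarith⟩
  -- the points of `B` with colour in `S` are too many for the subspace that contains them
  let BS : Set (Fin l × Option (Fin l × Fin l × Fin l)) := {v | v ∈ B ∧ v.1 ∈ S}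
  let emb : S ⊕ S → Fin l ⊕ Fin l := Sum.map Subtype.val Subtype.val
  let ext : (S ⊕ S → ℝ) →ₗ[ℝ] (Fin l ⊕ Fin l → ℝ) :=
    Function.ExtendByZero.linearMap ℝ emb
  let ψ : (Fin l ⊕ Fin l → ℝ) →ₗ[ℝ] ℝ :=
    ∑ k with w k = w kM, LinearMap.proj (Sum.inl k) - ∑ i, LinearMap.proj (Sum.inr i)
  have hψ : ∀ x, ψ x = ∑ k with w k = w kM, x (Sum.inl k) - ∑ i, x (Sum.inr i) := fun x => by
    simp [ψ]
  have hinj : Function.Injective emb :=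
    Subtype.val_injective.sumMap Subtype.val_injective
  have hcard : Fintype.card BS = 2 * S.card := by
    rw [← Set.toFinset_card, Finset.card_eq_sum_card_fiberwise (f := Prod.fst) (t := S)
      fun v hv => (Set.mem_toFinset.mp hv).2, Finset.sum_congr rfl (g := fun _ => 2),
      Finset.sum_const, smul_eq_mul, mul_comm]
    intro i hi
    rw [← hcount i, colorCount, ← Set.ncard_coe_finset]
    congr 1
    ext v
    simp only [BS, Finset.coe_filter, Set.mem_toFinset, Set.mem_ofPred_eq]
    exact ⟨fun h => ⟨h.1.1, h.2⟩, fun h => ⟨⟨h.1, h.2 ▸ hi⟩, h.2⟩⟩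
  have hspan : Module.finrank ℝ (Submodule.span ℝ (Set.range
      fun v : BS => cayley Prod.fst einsteinPoint v.1)) = Fintype.card BS :=
    finrank_span_eq_card (hB.mono fun v hv => hv.1).linearIndependent
  have hsub : Submodule.span ℝ (Set.range fun v : BS => cayley Prod.fst einsteinPoint v.1) ≤
      (LinearMap.ker (ψ ∘ₗ ext)).map ext := by
    rw [Submodule.span_le]
    rintro _ ⟨⟨⟨i, o⟩, hv, hi⟩, rfl⟩
    obtain ⟨k, a, b, rfl : o = _, hk, ha, hb⟩ := hS _ hv hi
    have hext : ext (cayley Prod.fst einsteinPoint (i, some (k, a, b)) ∘ emb) =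
        cayley Prod.fst einsteinPoint (i, some (k, a, b)) := by
      have hkS : k ∈ S := by simp [S, hk]
      have haS : a ∈ S := by simp [S, ha]
      have hbS : b ∈ S := by simp [S, hb]
      have hne : ∀ {u u'}, u' ∈ S → u ∉ S → u ≠ u' := fun h h' e => h' (e ▸ h)
      funext x
      by_cases hx : ∃ z, emb z = x
      · obtain ⟨z, rfl⟩ := hx
        exact hinj.extend_apply _ _ _
      · refine (Function.extend_apply' _ _ _ hx).trans ?_
        rcases x with x | x
        · have hxS : x ∉ S := fun h => hx ⟨Sum.inl ⟨x, h⟩, rfl⟩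
          simp [cayley, einsteinPoint, einsteinExp, triExp, hne hkS hxS, hne haS hxS, hne hbS hxS]
        · have hxS : x ∉ S := fun h => hx ⟨Sum.inr ⟨x, h⟩, rfl⟩
          simp [cayley, hne hi hxS]
    refine ⟨_, ?_, hext⟩
    simp only [SetLike.mem_coe, LinearMap.mem_ker, LinearMap.comp_apply]
    rw [hext, hψ]
    have ha' : w a ≠ w kM := ha ▸ hlt.ne
    have hb' : w b ≠ w kM := hb ▸ hlt.ne
    simp [cayley, einsteinPoint, einsteinExp, triExp, Pi.single_apply, Finset.sum_sub_distrib,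
      hk, ha', hb']
  have hproper : LinearMap.ker (ψ ∘ₗ ext) ≠ ⊤ := by
    intro htop
    have hkS : kM ∈ S := by simp [S]
    have : Pi.single (Sum.inl ⟨kM, hkS⟩) 1 ∈ LinearMap.ker (ψ ∘ₗ ext) := htop ▸ Submodule.mem_top
    have hext : ext (Pi.single (Sum.inl ⟨kM, hkS⟩) 1) = Pi.single (Sum.inl kM) 1 := by
      funext x
      by_cases hx : ∃ z, emb z = x
      · obtain ⟨z, rfl⟩ := hx
        refine (hinj.extend_apply _ _ _).trans ?_
        rcases z with z | z <;> simp [emb, Pi.single_apply, Subtype.ext_iff]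
      · refine (Function.extend_apply' _ _ _ hx).trans ?_
        have : x ≠ Sum.inl kM := fun h => hx ⟨Sum.inl ⟨kM, hkS⟩, h.symm⟩
        simp [this]
    rw [LinearMap.mem_ker, LinearMap.comp_apply, hext, hψ] at this
    simp [Pi.single_apply] at this
  have h4 := Submodule.finrank_mono hsub
  have h5 := Submodule.finrank_map_le ext (LinearMap.ker (ψ ∘ₗ ext))
  have h6 := Submodule.finrank_lt hproper
  simp only [Module.finrank_fintype_fun_eq_card, Fintype.card_sum, Fintype.card_coe] at h6
  omega

end Configuration

/-! ### The supports of the Einstein polynomials -/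

section Support

variable {K : Type*} [Field K] {l : ℕ}

lemma triExp_apply (k i j m : Fin l) :
    triExp k i j m = (if m = k then 1 else 0) - (if m = i then 1 else 0) -
      (if m = j then 1 else 0) := by
  simp [triExp, Pi.single_apply]

lemma triExp_ne_zero (k i j : Fin l) : triExp k i j ≠ 0 := by
  intro h
  have : ∑ m, triExp k i j m = 0 := by simp [h]
  simp [triExp, Finset.sum_sub_distrib] at this

lemma coeff_einsteinPoly (b d : Fin l → K) (L : Fin l → Fin l → Fin l → K) (i : Fin l)
    (a : Fin l → ℤ) : (einsteinPoly b d L i).coeff a =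
      (if triExp i i i = a then b i / 2 else 0) -
        1 / (4 * d i) * ∑ j, ∑ k, ((if triExp k i j = a then L i j k * 2 else 0) -
          (if triExp i j k = a then L i j k else 0)) - (if 0 = a then 1 else 0) := by
  have hk : ∀ j k : Fin l, (Pi.single k 2 + (Pi.single i (-1) + Pi.single j (-1) +
      Pi.single k (-1)) : Fin l → ℤ) = triExp k i j := by
    intro j k
    rw [triExp, show (2 : ℤ) = 1 + 1 from rfl, Pi.single_add]
    simp only [Pi.single_neg]
    abel
  have hi : ∀ j k : Fin l, (Pi.single i 2 + (Pi.single i (-1) + Pi.single j (-1) +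
      Pi.single k (-1)) : Fin l → ℤ) = triExp i j k := by
    intro j k
    rw [triExp, show (2 : ℤ) = 1 + 1 from rfl, Pi.single_add]
    simp only [Pi.single_neg]
    abel
  have hone : (Pi.single i (-1) : Fin l → ℤ) = triExp i i i := by
    rw [triExp, Pi.single_neg]; abel
  have hpoly : einsteinPoly b d L i = AddMonoidAlgebra.single (triExp i i i) (b i / 2) -
      AddMonoidAlgebra.single 0 (1 / (4 * d i)) *
        ∑ j, ∑ k, (AddMonoidAlgebra.single (triExp k i j) (L i j k * 2) -
          AddMonoidAlgebra.single (triExp i j k) (L i j k)) - AddMonoidAlgebra.single 0 1 := by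
    simp only [einsteinPoly, LaurentPoly.C, LaurentPoly.X, AddMonoidAlgebra.single_mul_single,
      sub_mul, mul_sub, zero_add, mul_one, hk, hi, AddMonoidAlgebra.one_def, ← hone]
  rw [hpoly]
  simp only [AddMonoidAlgebra.coeff_sub, AddMonoidAlgebra.coeff_sum, AddMonoidAlgebra.coeff_single,
    AddMonoidAlgebra.coeff_single_zero_mul, Finsupp.sub_apply, Finsupp.finsetSum_apply,
    Finsupp.single_apply]

lemma support_einsteinPoly_subset (b d : Fin l → K) (L : Fin l → Fin l → Fin l → K) (i : Fin l) :
    (einsteinPoly b d L i).support ⊆ Set.range einsteinExp := by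
  intro a ha
  by_contra hne
  have h0 : (0 : Fin l → ℤ) ≠ a := fun h => hne ⟨none, h⟩
  have h1 : ∀ k i j, triExp k i j ≠ a := fun k i j h => hne ⟨some (k, i, j), h⟩
  exact ha (by simp [coeff_einsteinPoly, h0, h1])

lemma zero_mem_support_einsteinPoly (b d : Fin l → K) (L : Fin l → Fin l → Fin l → K)
    (i : Fin l) : 0 ∈ (einsteinPoly b d L i).support := by
  simp [LaurentPoly.support, coeff_einsteinPoly, triExp_ne_zero]

lemma coeff_einsteinPoly_self_sub_two (b d : Fin l → K) (L : Fin l → Fin l → Fin l → K)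
    {i q : Fin l} (hiq : i ≠ q) :
    (einsteinPoly b d L i).coeff (triExp i q q) = 1 / (4 * d i) * L i q q := by
  have h1 : ∀ k j, triExp k i j ≠ triExp i q q := by
    intro k j h
    have := congrFun h i
    simp only [triExp_apply, if_neg hiq] at this
    split_ifs at this <;> omega
  have h2 : ∀ j k, triExp i j k = triExp i q q ↔ q = j ∧ q = k := by
    refine fun j k => ⟨fun h => ?_, by rintro ⟨rfl, rfl⟩; rfl⟩
    have := congrFun h q
    simp only [triExp_apply, if_neg hiq.symm] at this
    split_ifs at this <;> first | exact ⟨‹_›, ‹_›⟩ | omega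
  rw [coeff_einsteinPoly]
  simp [h1, h2, (triExp_ne_zero _ _ _).symm, ite_and]

lemma coeff_einsteinPoly_sub_two_self (b d : Fin l → K) (L : Fin l → Fin l → Fin l → K)
    {i q : Fin l} (hiq : i ≠ q) :
    (einsteinPoly b d L i).coeff (triExp q i i) = -(1 / (4 * d i) * (L i i q * 2)) := by
  have h1 : ∀ k j, triExp k i j = triExp q i i ↔ i = j ∧ q = k := by
    refine fun k j => ⟨fun h => ?_, by rintro ⟨rfl, rfl⟩; rfl⟩
    have e1 := congrFun h q
    have e2 := congrFun h i
    simp only [triExp_apply, if_neg hiq.symm, if_neg hiq] at e1 e2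
    split_ifs at e1 e2 <;> first | exact ⟨‹_›, ‹_›⟩ | (subst_vars; omega)
  have h2 : ∀ j k, triExp i j k ≠ triExp q i i := by
    intro j k h
    have := congrFun h i
    simp only [triExp_apply, if_neg hiq] at this
    split_ifs at this <;> omega
  rw [coeff_einsteinPoly]
  simp [h1, h2, (triExp_ne_zero _ _ _).symm, ite_and, hiq.symm]

lemma coeff_einsteinPoly_of_subsingleton [Subsingleton (Fin l)] (b d : Fin l → K)
    (L : Fin l → Fin l → Fin l → K) (i : Fin l) :
    (einsteinPoly b d L i).coeff (triExp i i i) = b i / 2 - 1 / (4 * d i) * L i i i := by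
  have : Unique (Fin l) := uniqueOfSubsingleton i
  have hi : (default : Fin l) = i := Subsingleton.elim _ _
  rw [coeff_einsteinPoly]
  simp only [Fintype.sum_unique, hi, if_true, if_neg (triExp_ne_zero i i i).symm]
  ring

end Support

/-! ### The mixed volume of the Einstein equations -/

lemma newton_einsteinPoly_eq {K : Type*} [Field K] {l : ℕ} (b d : Fin l → K)
    (L : Fin l → Fin l → Fin l → K) (i : Fin l) :
    (einsteinPoly b d L i).newton = convexHull ℝ (einsteinPoint ''
      {v | v ∈ {v : Fin l × Option (Fin l × Fin l × Fin l) |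
        einsteinExp v.2 ∈ (einsteinPoly b d L v.1).support} ∧ v.1 = i}) := by
  rw [LaurentPoly.newton]
  congr 1
  ext x
  constructor
  · rintro ⟨a, ha, rfl⟩
    obtain ⟨o, rfl⟩ := support_einsteinPoly_subset b d L i ha
    exact ⟨(i, o), ⟨ha, rfl⟩, rfl⟩
  · rintro ⟨⟨i', o⟩, ⟨ho, rfl : i' = i⟩, rfl⟩
    exact ⟨einsteinExp o, ho, rfl⟩

theorem mainTheorem7 {K : Type*} [Field K] [CharZero K] (l : ℕ)
    (b d : Fin l → K) (L : Fin l → Fin l → Fin l → K)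
    (hsymm : ∀ i j k, L i j k = L j i k ∧ L i j k = L i k j)
    (hd : ∀ i, d i ≠ 0)
    (hL : ∀ i j, i ≠ j → L i i j ≠ 0)
    (hone : l = 1 → ∀ i, L i i i ≠ 2 * b i * d i) :
    IsMixedVolume (fun i => (einsteinPoly b d L i).newton)
      (normalizedVolume (einsteinPolytope l)) := by
  let T : Set (Fin l × Option (Fin l × Fin l × Fin l)) :=
    {v | einsteinExp v.2 ∈ (einsteinPoly b d L v.1).support}
  obtain ⟨m, hm, hm'⟩ : ∃ m, IsMixedVolume (fun i => convexHull ℝ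
        (einsteinPoint '' {v | v ∈ T ∧ v.1 = i})) m ∧
      IsMixedVolume (fun i => convexHull ℝ (einsteinPoint '' {v | v.1 = i})) m := by
    refine exists_isMixedVolume_subset_and_univ T fun B y hB hcount hy hyB => ?_
    refine subset_of_functional_le_indicator (fun i => zero_mem_support_einsteinPoly b d L i)
      (fun i j hij => ?_) (fun i j hij => ?_) (fun hl i => ?_) y hB hcount hy hyB
    · have hLij : L i j j ≠ 0 := by
        rw [(hsymm i j j).1, (hsymm j i j).2]; exact hL j i hij.symm
      change (einsteinPoly b d L i).coeff (triExp i j j) ≠ 0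
      rw [coeff_einsteinPoly_self_sub_two b d L hij]
      simp [hd, hLij]
    · change (einsteinPoly b d L i).coeff (triExp j i i) ≠ 0
      rw [coeff_einsteinPoly_sub_two_self b d L hij]
      simp [hd, hL i j hij]
    · subst hl
      change (einsteinPoly b d L i).coeff (triExp i i i) ≠ 0
      rw [coeff_einsteinPoly_of_subsingleton]
      intro h
      refine hone rfl i ?_
      have := hd i
      field_simp at h
      linear_combination -h / 2
  simp only [newton_einsteinPoly_eq]
  simp only [convexHull_range_einsteinPoint] at hm'
  have hne : (einsteinPolytope l).Nonempty := ⟨0, subset_convexHull ℝ _ (Or.inl rfl)⟩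
  rwa [← hm'.unique (isMixedVolume_const (convex_convexHull ℝ _) hne)]
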